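/- \textbf{Setting.} Let $G$ be a finite tree whose vertices are the buses of a power grid; one bus is the substation. Let $\mathcal T$ be the graph induced by $G$ on the non-substation buses. Assume that $\mathcal T$ is connected (equivalently, the substation is attached by a single line), so that $\mathcal T$ is a tree, and that $\mathcal T$ contains a path with more than three edges. A node is \emph{non-leaf} if its degree in $\mathcal T$ is greater than $1$. Write $E$ for the edge set of $G$ and $\mathbf i$ for the imaginary unit. Bus $b$ has random voltage magnitude $v_b$ and phase angle $\theta_b$, each bus $n\neq$ substation has a random complex injection $P_n=p_n+\mathbf i q_n$, and one of the following linearized power-flow models holds. \emph{Single phase (LC-PF).} Every line has an impedance $Z_{ij}=Z_{ji}\in\mathbb C\setminus\{0\}$, the substation has $v=1$, $\theta=0$, and at each non-substation bus $i$ $$P_i=\sum_{j:(ij)\in E}\frac{(v_i-v_j)-\mathbf i(\theta_i-\theta_j)}{Z_{ij}^*}.$$ Put $V_i=v_i-\mathbf i\theta_i\in\mathbb C$. \emph{Three phase (LC-PF3).} Every line has a symmetric invertible impedance matrix $Z_{ij}=Z_{ji}\in\mathbb C^{3\times3}$ with $Y_{ij}=(Z_{ij}^H)^{-1}$; all quantities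 at a bus have components in the phases $a,b,c$; with $(\theta^a_{ref},\theta^b_{ref},\theta^c_{ref})=(0,2\pi/3,-2\pi/3)$ the substation has $v^\alpha=1$, $\theta^\alpha=\theta^\alpha_{ref}$, and at each non-substation bus $i$ and phase $\alpha$ $$P^\alpha_i=\sum_{\beta}e^{\mathbf i(\theta^\alpha_{ref}-\theta^\beta_{ref})}\sum_{j:(ij)\in E}\bigl((v^\beta_i-v^\beta_j)-\mathbf i(\theta^\beta_i-\theta^\beta_j)\bigr)Y^{\alpha\beta}_{ij}.$$ Put $V_i=\bigl(e^{-\mathbf i\theta^\alpha_{ref}}(v^\alpha_i-\mathbf i\theta^\alpha_i)\bigr)_{\alpha}\in\mathbb C^3$. Assume that the injections at different non-substation buses are jointly independent and that the injection at each bus has a probability density with respect to Lebesgue measure (on $\mathbb C$, respectively $\mathbb C^3$). Let $H$ be the graph on the vertices of $\mathcal T$ in which two distinct vertices are adjacent iff they are one or two hops apart in $\mathcal T$. Assume the voltages are faithful to $H$ in the following sense: for pairwise distinct $i,j,k,l$, if removing $i,j$ from $H$ does not separate $k$ from $l$, then $V_k$ and $V_l$ are not conditionally independent given $(V_i,V_j)$.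 \textbf{Theorem.} In each of the two models, for all distinct non-substation buses $i,j$: $(ij)$ is an edge of $\mathcal T$ between two non-leaf nodes of $\mathcal T$ if and only if there are nodes $k,l$ of $\mathcal T$, with $i,j,k,l$ pairwise distinct, such that $V_k$ and $V_l$ are conditionally independent given $(V_i,V_j)$. -/

import Mathlib

open MeasureTheory ProbabilityTheory

noncomputable section

namespace PowerGrid

/-! Buses of a grid are `Option N`: `none` is the substation (the reference bus) and `some n`,
`n : N`, are the non-substation buses. -/

/-- The operational tree without the substation: the graph induced on the non-substation buses. -/
def loadTree {N : Type*} (G : SimpleGraph (Option N)) : SimpleGraph N :=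
  G.comap some

/-- A non-leaf node of `T`: a node of degree greater than `1`. -/
def IsNonLeaf {N : Type*} (T : SimpleGraph N) (i : N) : Prop :=
  1 < (T.neighborSet i).encard

/-- The length (number of edges) of the longest path of `T` is greater than three. -/
def DepthGreaterThanThree {N : Type*} (T : SimpleGraph N) : Prop :=
  ∃ (a b : N) (p : T.Walk a b), p.IsPath ∧ 3 < p.length

/-- The graph of the graphical model: its edges join distinct nodes that are one hop or two hops
away from each other in `T`. -/
def hopGraph {N : Type*} (T : SimpleGraph N) : SimpleGraph N where
  Adj k l := k ≠ l ∧ (T.Adj k l ∨ ∃ m, T.Adj k m ∧ T.Adj m l)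
  symm := ⟨fun _ _ h => ⟨h.1.symm, h.2.elim (fun h₁ => Or.inl h₁.symm)
    (fun ⟨m, h₁, h₂⟩ => Or.inr ⟨m, h₂.symm, h₁.symm⟩)⟩⟩
  loopless := ⟨fun _ h => h.1 rfl⟩

/-- Removal of the vertex set `C` separates `k` from `l` in `H`: every walk from `k` to `l`
meets `C`. -/
def Separates {N : Type*} (H : SimpleGraph N) (C : Set N) (k l : N) : Prop :=
  ∀ p : H.Walk k l, ∃ x ∈ p.support, x ∈ C

/-! ### Single-phase linear coupled power flow -/

open scoped Classical in
/-- The LC-PF equations `P_i = ∑_{j : (ij) ∈ E} ((v_i - v_j) - 𝐢 (θ_i - θ_j)) / Z_{ij}^*` at every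
non-substation bus, with voltage magnitude `1` and phase angle `0` at the substation. Here `P_i` is
the complex injection `p_i + 𝐢 q_i` and `Z` the complex impedance of the lines. -/
structure IsLCPF {N : Type*} [Fintype N] (G : SimpleGraph (Option N))
    (Z : Sym2 (Option N) → ℂ) (v θ : Option N → ℝ) (P : N → ℂ) : Prop where
  ref_magnitude : v none = 1
  ref_angle : θ none = 0
  flow : ∀ i : N, P i = ∑ j : Option N, if G.Adj (some i) j then
    (((v (some i) - v j : ℝ) : ℂ) - Complex.I * ((θ (some i) - θ j : ℝ) : ℂ)) /
      star (Z s(some i, j)) else 0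

/-- The complex voltages `V¹_i = v_i - 𝐢 θ_i` at the non-substation buses. -/
def voltage₁ {N Ω : Type*} (v θ : Option N → Ω → ℝ) (i : N) (ω : Ω) : ℂ :=
  (v (some i) ω : ℂ) - Complex.I * (θ (some i) ω : ℂ)

theorem measurable_voltage₁ {N Ω : Type*} [MeasurableSpace Ω] {v θ : Option N → Ω → ℝ}
    (hv : ∀ b, Measurable (v b)) (hθ : ∀ b, Measurable (θ b)) (i : N) :
    Measurable (voltage₁ v θ i) :=
  (Complex.measurable_ofReal.comp (hv (some i))).sub
    ((Complex.measurable_ofReal.comp (hθ (some i))).const_mul Complex.I)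

/-! ### Three-phase linear coupled power flow -/

/-- The reference phase angles `0, 2π/3, -2π/3` of the phases `a, b, c`. -/
def θref : Fin 3 → ℝ :=
  ![0, 2 * Real.pi / 3, -(2 * Real.pi / 3)]

open scoped Classical in
/-- The LC-PF3 equations
`P_i^α = ∑_β e^{𝐢 (θref^α - θref^β)} ∑_{j : (ij) ∈ E} ((v_i^β - v_j^β) - 𝐢 (θ_i^β - θ_j^β)) Y_{ij}^{αβ}`
at every non-substation bus, with unit voltage magnitudes and reference phase angles at the
substation. `Z` is the 3 × 3 impedance matrix of the lines and `Y_{ij} = (Z_{ij}^H)⁻¹`. -/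
structure IsLCPF3 {N : Type*} [Fintype N] (G : SimpleGraph (Option N))
    (Z : Sym2 (Option N) → Matrix (Fin 3) (Fin 3) ℂ) (v θ : Option N → Fin 3 → ℝ)
    (P : N → Fin 3 → ℂ) : Prop where
  ref_magnitude : ∀ α, v none α = 1
  ref_angle : ∀ α, θ none α = θref α
  flow : ∀ (i : N) (α : Fin 3), P i α = ∑ β : Fin 3,
    Complex.exp (Complex.I * ((θref α - θref β : ℝ) : ℂ)) *
      ∑ j : Option N, if G.Adj (some i) j then
        (((v (some i) β - v j β : ℝ) : ℂ) - Complex.I * ((θ (some i) β - θ j β : ℝ) : ℂ)) *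
          ((Z s(some i, j)).conjTranspose)⁻¹ α β else 0

/-- The complex voltages `V†_i`, with phase components `e^{-𝐢 θref^α} (v_i^α - 𝐢 θ_i^α)`, at the
non-substation buses. -/
def voltage₃ {N Ω : Type*} (v θ : Option N → Ω → Fin 3 → ℝ) (i : N) (ω : Ω) : Fin 3 → ℂ :=
  fun α => Complex.exp (-(Complex.I * (θref α : ℂ))) *
    ((v (some i) ω α : ℂ) - Complex.I * (θ (some i) ω α : ℂ))

theorem measurable_voltage₃ {N Ω : Type*} [MeasurableSpace Ω] {v θ : Option N → Ω → Fin 3 → ℝ}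
    (hv : ∀ b, Measurable (v b)) (hθ : ∀ b, Measurable (θ b)) (i : N) :
    Measurable (voltage₃ v θ i) :=
  measurable_pi_lambda _ fun α =>
    ((Complex.measurable_ofReal.comp ((measurable_pi_apply α).comp (hv (some i)))).sub
      ((Complex.measurable_ofReal.comp
        ((measurable_pi_apply α).comp (hθ (some i)))).const_mul Complex.I)).const_mul _

/-! ### Statistics of injections and voltages -/

/-- The injections at different nodes are independent continuous random vectors: jointly
independent, and each has a probability density function with respect to Lebesgue measure.
(The real components of an injection at a single node may depend on each other.) -/
structure IndependentInjections {N Ω E : Type*} [MeasurableSpace Ω] [MeasureSpace E]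
    (P : N → Ω → E) (μ : Measure Ω) : Prop where
  measurable : ∀ i, Measurable (P i)
  indep : iIndepFun P μ
  density : ∀ i, HasPDF (P i) μ volume

/-- `V_k` and `V_l` are conditionally independent given `(V_i, V_j)`. -/
def CondIndepGivenPair {N Ω E : Type*} [MeasurableSpace Ω] [StandardBorelSpace Ω]
    [MeasurableSpace E] (μ : Measure Ω) [IsFiniteMeasure μ] {V : N → Ω → E}
    (hV : ∀ n, Measurable (V n)) (k l i j : N) : Prop :=
  V k ⟂ᵢ[fun ω => (V i ω, V j ω), (hV i).prodMk (hV j); μ] V l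

/-- Faithfulness of the voltages to the graphical model `H`, for conditioning on two nodes: if
removal of `i, j` does not separate `k` from `l` in `H`, then `V_k` and `V_l` are conditionally
dependent given `(V_i, V_j)`. -/
def FaithfulTo {N Ω E : Type*} [MeasurableSpace Ω] [StandardBorelSpace Ω]
    [MeasurableSpace E] (H : SimpleGraph N) (μ : Measure Ω) [IsFiniteMeasure μ] {V : N → Ω → E}
    (hV : ∀ n, Measurable (V n)) : Prop :=
  ∀ i j k l : N, [i, j, k, l].Nodup → ¬ Separates H {i, j} k l →
    ¬ CondIndepGivenPair μ hV k l i j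

end PowerGrid

end

/-! Forward direction. Deleting the edge `ij` splits the grid in two; let `D` be the part without
the substation, say the one containing `j`. Flow conservation makes the flow `F` over the edge both
the sum of the injections in `D` and a function of `V j - V i`. Telescoping voltage drops along
walks shows that `V l - V j` depends only on injections in `D` when `l` lies in `D`, and that for
`k` outside `D` the voltage `V k` is a function of `F` plus a function of the injections outside
`D`. In particular `V i = R + ci F`, so conditioning on `(V i, V j)` means conditioning on `(R, F)`:
one variable from each of two independent families, which leaves the families independent
(`condIndep_sup_of_indep`). This gives `condIndepFun_potential_of_adj`; `k` and `l` are further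
neighbours of the non-leaf nodes `i` and `j`.

Converse. Faithfulness turns conditional independence into separation in the hop graph. A tree path
from `k` to `l` can jump over `i` or `j` by a two-hop edge unless it visits them consecutively, and
then they are adjacent non-leaf nodes (`adj_and_isNonLeaf_of_separates`).

Both models are instances of one network flow with additive admittances `y` and left inverses `z`
(`exists_condIndepGivenPair_iff`). -/

namespace PowerGrid

/-! ### Conditional independence given one sub-σ-algebra from each of two independent ones. -/

section CondIndep

variable {Ω : Type*}

theorem isPiSystem_inter_measurableSet (m₁ m₂ : MeasurableSpace Ω) :
    IsPiSystem {u : Set Ω | ∃ a b, MeasurableSet[m₁] a ∧ MeasurableSet[m₂] b ∧ u = a ∩ b} := by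
  rintro _ ⟨a, b, ha, hb, rfl⟩ _ ⟨a', b', ha', hb', rfl⟩ -
  exact ⟨a ∩ a', b ∩ b', ha.inter ha', hb.inter hb', Set.inter_inter_inter_comm _ _ _ _⟩

theorem sup_eq_generateFrom_inter (m₁ m₂ : MeasurableSpace Ω) :
    m₁ ⊔ m₂ = MeasurableSpace.generateFrom
      {u : Set Ω | ∃ a b, MeasurableSet[m₁] a ∧ MeasurableSet[m₂] b ∧ u = a ∩ b} := by
  apply le_antisymm
  · refine sup_le (fun a ha => ?_) (fun b hb => ?_)
    · exact MeasurableSpace.measurableSet_generateFrom ⟨a, Set.univ, ha, .univ, by simp⟩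
    · exact MeasurableSpace.measurableSet_generateFrom ⟨Set.univ, b, .univ, hb, by simp⟩
  · refine MeasurableSpace.generateFrom_le ?_
    rintro _ ⟨a, b, ha, hb, rfl⟩
    exact MeasurableSet.inter ((le_sup_left : m₁ ≤ m₁ ⊔ m₂) _ ha)
      ((le_sup_right : m₂ ≤ m₁ ⊔ m₂) _ hb)

variable {m₁ m₂ n₁ n₂ : MeasurableSpace Ω} {mΩ : MeasurableSpace Ω} {μ : Measure Ω}
  [IsProbabilityMeasure μ]

theorem integrable_indicator_one {s : Set Ω} (hs : MeasurableSet s) :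
    Integrable (s.indicator fun _ => (1 : ℝ)) μ :=
  (integrable_const 1).indicator hs

/-- By independence both integrals over a rectangle factor into `μ (a ∩ s) * μ (b ∩ t)`. -/
theorem setIntegral_condExp_mul_condExp (h₁ : m₁ ≤ mΩ) (h₂ : m₂ ≤ mΩ) (hind : Indep m₁ m₂ μ)
    (hn₁ : n₁ ≤ m₁) (hn₂ : n₂ ≤ m₂) {s t a b : Set Ω} (hs : MeasurableSet[m₁] s)
    (ht : MeasurableSet[m₂] t) (ha : MeasurableSet[n₁] a) (hb : MeasurableSet[n₂] b) :
    ∫ ω in a ∩ b, ((μ⟦s | n₁⟧) * (μ⟦t | n₂⟧)) ω ∂μ =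
      ∫ ω in a ∩ b, (s ∩ t).indicator (fun _ => (1 : ℝ)) ω ∂μ := by
  have h1 : Measurable[m₁] (a.indicator (μ⟦s | n₁⟧)) :=
    ((stronglyMeasurable_condExp.measurable).mono hn₁ le_rfl).indicator (hn₁ _ ha)
  have h2 : Measurable[m₂] (b.indicator (μ⟦t | n₂⟧)) :=
    ((stronglyMeasurable_condExp.measurable).mono hn₂ le_rfl).indicator (hn₂ _ hb)
  have hif : IndepFun (a.indicator (μ⟦s | n₁⟧)) (b.indicator (μ⟦t | n₂⟧)) μ := by
    rw [IndepFun_iff_Indep]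
    exact indep_of_indep_of_le_left (indep_of_indep_of_le_right hind h2.comap_le) h1.comap_le
  have ha' := h₁ _ (hn₁ _ ha)
  have hb' := h₂ _ (hn₂ _ hb)
  have hs' := h₁ _ hs
  have ht' := h₂ _ ht
  have hmul : (a ∩ b).indicator ((μ⟦s | n₁⟧) * (μ⟦t | n₂⟧)) =
      a.indicator (μ⟦s | n₁⟧) * b.indicator (μ⟦t | n₂⟧) := by
    ext ω
    by_cases h : ω ∈ a <;> by_cases h' : ω ∈ b <;> simp [h, h']
  rw [← integral_indicator (ha'.inter hb'), hmul,
    hif.integral_mul_eq_mul_integral (h1.mono h₁ le_rfl).aestronglyMeasurable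
      (h2.mono h₂ le_rfl).aestronglyMeasurable,
    integral_indicator ha', integral_indicator hb',
    setIntegral_condExp (hn₁.trans h₁) (integrable_indicator_one hs') ha,
    setIntegral_condExp (hn₂.trans h₂) (integrable_indicator_one ht') hb,
    setIntegral_indicator hs', setIntegral_indicator ht', setIntegral_indicator (hs'.inter ht')]
  simp only [integral_const, smul_eq_mul, mul_one, measureReal_restrict_apply_univ]
  have := (Indep_iff m₁ m₂ μ).1 hind _ _ ((hn₁ _ ha).inter hs) ((hn₂ _ hb).inter ht)
  rw [Set.inter_inter_inter_comm, measureReal_def, measureReal_def, measureReal_def, this,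
    ENNReal.toReal_mul]

theorem condExp_inter_of_indep (h₁ : m₁ ≤ mΩ) (h₂ : m₂ ≤ mΩ) (hind : Indep m₁ m₂ μ)
    (hn₁ : n₁ ≤ m₁) (hn₂ : n₂ ≤ m₂) {s t : Set Ω} (hs : MeasurableSet[m₁] s)
    (ht : MeasurableSet[m₂] t) :
    μ⟦s ∩ t | n₁ ⊔ n₂⟧ =ᵐ[μ] (μ⟦s | n₁⟧) * (μ⟦t | n₂⟧) := by
  have hm : n₁ ⊔ n₂ ≤ mΩ := sup_le (hn₁.trans h₁) (hn₂.trans h₂)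
  have hst : MeasurableSet (s ∩ t) := (h₁ _ hs).inter (h₂ _ ht)
  have hgi : Integrable ((μ⟦s | n₁⟧) * (μ⟦t | n₂⟧)) μ := by
    refine IndepFun.integrable_mul ?_ integrable_condExp integrable_condExp
    rw [IndepFun_iff_Indep]
    exact indep_of_indep_of_le_left (indep_of_indep_of_le_right hind
      ((stronglyMeasurable_condExp.measurable).comap_le.trans hn₂))
      ((stronglyMeasurable_condExp.measurable).comap_le.trans hn₁)
  have hfi := integrable_indicator_one (μ := μ) hst
  symm
  refine ae_eq_condExp_of_forall_setIntegral_eq hm hfi (fun _ _ _ => hgi.integrableOn) ?_ ?_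
  · intro u hu _
    induction u, hu using MeasurableSpace.induction_on_inter (sup_eq_generateFrom_inter n₁ n₂)
      (isPiSystem_inter_measurableSet n₁ n₂) with
    | empty => simp
    | basic u hu =>
      obtain ⟨a, b, ha, hb, rfl⟩ := hu
      exact setIntegral_condExp_mul_condExp h₁ h₂ hind hn₁ hn₂ hs ht ha hb
    | compl u hu ih =>
      rw [setIntegral_compl (hm _ hu) hgi, setIntegral_compl (hm _ hu) hfi, ih (measure_lt_top _ _)]
      congr 1
      -- The whole space is itself a rectangle, so the total integrals agree.
      have := setIntegral_condExp_mul_condExp h₁ h₂ hind hn₁ hn₂ hs ht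
        (MeasurableSet.univ (m := n₁)) (MeasurableSet.univ (m := n₂))
      simpa only [Set.univ_inter, Measure.restrict_univ] using this
    | iUnion f hd hf ih =>
      rw [integral_iUnion (fun i => hm _ (hf i)) hd hgi.integrableOn,
        integral_iUnion (fun i => hm _ (hf i)) hd hfi.integrableOn]
      exact tsum_congr fun i => ih i (measure_lt_top _ _)
  · exact ((stronglyMeasurable_condExp.mono le_sup_left).mul
      (stronglyMeasurable_condExp.mono le_sup_right)).aestronglyMeasurable

/-- Sets `s ∩ a` with `a` in the conditioning σ-algebra form a generating π-system; the indicator of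
`a` leaves the conditional expectation, and what remains is the product formula
`condExp_inter_of_indep`. -/
theorem condIndep_sup_of_indep [StandardBorelSpace Ω] (h₁ : m₁ ≤ mΩ) (h₂ : m₂ ≤ mΩ)
    (hind : Indep m₁ m₂ μ) (hn₁ : n₁ ≤ m₁) (hn₂ : n₂ ≤ m₂) (hm : n₁ ⊔ n₂ ≤ mΩ) :
    CondIndep (n₁ ⊔ n₂) (m₁ ⊔ (n₁ ⊔ n₂)) (m₂ ⊔ (n₁ ⊔ n₂)) hm μ := by
  refine CondIndepSets.condIndep (sup_le h₁ hm) (sup_le h₂ hm)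
    (isPiSystem_inter_measurableSet m₁ (n₁ ⊔ n₂)) (isPiSystem_inter_measurableSet m₂ (n₁ ⊔ n₂))
    (sup_eq_generateFrom_inter _ _) (sup_eq_generateFrom_inter _ _) ?_
  rw [condIndepSets_iff]
  rotate_left
  · rintro _ ⟨a, b, ha, hb, rfl⟩
    exact (h₁ _ ha).inter (hm _ hb)
  · rintro _ ⟨a, b, ha, hb, rfl⟩
    exact (h₂ _ ha).inter (hm _ hb)
  rintro _ _ ⟨s, a, hs, ha, rfl⟩ ⟨t, b, ht, hb, rfl⟩
  have hs' := h₁ _ hs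
  have ht' := h₂ _ ht
  have key : ∀ {u c : Set Ω}, MeasurableSet u → MeasurableSet[n₁ ⊔ n₂] c →
      μ⟦u ∩ c | n₁ ⊔ n₂⟧ =ᵐ[μ] c.indicator (μ⟦u | n₁ ⊔ n₂⟧) := by
    intro u c hu hc
    have := condExp_indicator (integrable_indicator_one (μ := μ) hu) hc
    rwa [Set.indicator_indicator, Set.inter_comm] at this
  have hst := condExp_inter_of_indep h₁ h₂ hind hn₁ hn₂ hs ht
  -- With the whole space as the other set, conditioning on the independent factor drops out.
  have hs1 := condExp_inter_of_indep h₁ h₂ hind hn₁ hn₂ hs MeasurableSet.univ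
  have ht1 := condExp_inter_of_indep h₁ h₂ hind hn₁ hn₂ MeasurableSet.univ ht
  simp only [Set.indicator_univ, condExp_const (hn₁.trans h₁), condExp_const (hn₂.trans h₂),
    Set.univ_inter, Set.inter_univ] at hs1 ht1
  rw [Set.inter_inter_inter_comm]
  filter_upwards [key (hs'.inter ht') (ha.inter hb), key hs' ha, key ht' hb, hst, hs1, ht1]
    with ω e1 e2 e3 e4 e5 e6
  rw [Pi.mul_apply, e1, e2, e3]
  by_cases hωa : ω ∈ a <;> by_cases hωb : ω ∈ b <;> simp [hωa, hωb, e4, e5, e6]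

end CondIndep

/-! ### Separation in the hop graph. -/

theorem isNonLeaf_of_adj {N : Type*} {T : SimpleGraph N} {x y z : N} (hy : T.Adj x y)
    (hz : T.Adj x z) (hne : y ≠ z) : IsNonLeaf T x :=
  Set.one_lt_encard_iff.2 ⟨y, z, hy, hz, hne⟩

theorem IsNonLeaf.exists_adj_ne {N : Type*} {T : SimpleGraph N} {x : N} (h : IsNonLeaf T x)
    (y : N) : ∃ z, T.Adj x z ∧ z ≠ y := by
  obtain ⟨a, b, ha, hb, hne⟩ := Set.one_lt_encard_iff.1 h
  by_cases hay : a = y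
  · exact ⟨b, hb, fun hby => hne (hay.trans hby.symm)⟩
  · exact ⟨a, ha, hay⟩

theorem hopGraph_adj_of_adj {N : Type*} {T : SimpleGraph N} {x y : N} (h : T.Adj x y) :
    (hopGraph T).Adj x y :=
  ⟨h.ne, Or.inl h⟩

theorem hopGraph_adj_of_adj_of_adj {N : Type*} {T : SimpleGraph N} {x y z : N} (hne : x ≠ z)
    (h : T.Adj x y) (h' : T.Adj y z) : (hopGraph T).Adj x z :=
  ⟨hne, Or.inr ⟨y, h, h'⟩⟩

/-- Shortcut the path: a single forbidden vertex is skipped by a two-hop edge. Two consecutive ones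
would be `i` and `j`, each with a further neighbour on the path, which `hij` excludes. -/
theorem exists_hopGraph_walk_of_isPath {N : Type*} {T : SimpleGraph N} {i j : N}
    (hij : ¬ (T.Adj i j ∧ IsNonLeaf T i ∧ IsNonLeaf T j)) {l : N} (hl : l ∉ ({i, j} : Set N)) :
    ∀ {k : N} (p : T.Walk k l), p.IsPath → k ∉ ({i, j} : Set N) →
      ∃ q : (hopGraph T).Walk k l, ∀ x ∈ q.support, x ∉ ({i, j} : Set N)
  | _, .nil, _, hk => ⟨.nil, by simpa using hk⟩
  | k, .cons (v := a) h .nil, _, hk => by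
    refine ⟨.cons (hopGraph_adj_of_adj h) .nil, ?_⟩
    simp only [SimpleGraph.Walk.support_cons, SimpleGraph.Walk.support_nil, List.mem_cons,
      List.not_mem_nil, or_false, forall_eq_or_imp, forall_eq]
    exact ⟨hk, hl⟩
  | k, .cons (v := a) h (.cons (v := b) h' p), hp, hk => by
    have hp' := hp.of_cons
    by_cases ha : a ∈ ({i, j} : Set N)
    · have hkb : k ≠ b := by
        rintro rfl
        simp [SimpleGraph.Walk.cons_isPath_iff] at hp
      by_cases hb : b ∈ ({i, j} : Set N)
      · exfalso
        have hna : IsNonLeaf T a := isNonLeaf_of_adj h.symm h' hkb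
        have hnb : IsNonLeaf T b := by
          -- The path cannot stop at `b`, since its end `l` is allowed; the next vertex is the
          -- second neighbour of `b`.
          match b, p with
          | _, .nil => exact absurd hb hl
          | _, .cons (v := c) h'' p' =>
            refine isNonLeaf_of_adj h'.symm h'' ?_
            rintro rfl
            simp [SimpleGraph.Walk.cons_isPath_iff] at hp'
        have hab := h'.ne
        simp only [Set.mem_insert_iff, Set.mem_singleton_iff] at ha hb
        rcases ha with rfl | rfl <;> rcases hb with rfl | rfl
        · exact hab rfl
        · exact hij ⟨h', hna, hnb⟩
        · exact hij ⟨h'.symm, hnb, hna⟩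
        · exact hab rfl
      · obtain ⟨q, hq⟩ := exists_hopGraph_walk_of_isPath hij hl p hp'.of_cons hb
        refine ⟨.cons (hopGraph_adj_of_adj_of_adj hkb h h') q, ?_⟩
        simp only [SimpleGraph.Walk.support_cons, List.mem_cons, forall_eq_or_imp]
        exact ⟨hk, hq⟩
    · obtain ⟨q, hq⟩ := exists_hopGraph_walk_of_isPath hij hl (.cons h' p) hp' ha
      refine ⟨.cons (hopGraph_adj_of_adj h) q, ?_⟩
      simp only [SimpleGraph.Walk.support_cons, List.mem_cons, forall_eq_or_imp]
      exact ⟨hk, hq⟩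

theorem adj_and_isNonLeaf_of_separates {N : Type*} {T : SimpleGraph N} (hT : T.Connected)
    {i j k l : N} (hk : k ∉ ({i, j} : Set N)) (hl : l ∉ ({i, j} : Set N))
    (hsep : Separates (hopGraph T) {i, j} k l) : T.Adj i j ∧ IsNonLeaf T i ∧ IsNonLeaf T j := by
  by_contra hij
  classical
  obtain ⟨p, hp⟩ := hT.exists_isPath k l
  obtain ⟨q, hq⟩ := exists_hopGraph_walk_of_isPath hij hl p hp hk
  obtain ⟨x, hx, hxc⟩ := hsep q
  exact hq x hx hxc

/-! ### The two sides of an edge of a tree. -/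

/-- A set of vertices that is left by no edge except `s(a, b)`, with `a` inside and `b` outside. -/
structure IsCut {B : Type*} (G : SimpleGraph B) (S : Set B) (a b : B) : Prop where
  adj : G.Adj a b
  left_mem : a ∈ S
  right_notMem : b ∉ S
  eq_of_adj : ∀ ⦃x z⦄, x ∈ S → z ∉ S → G.Adj x z → x = a ∧ z = b

/-- The vertices that `a` reaches without the edge `s(a, b)`. -/
def side {B : Type*} (G : SimpleGraph B) (a b : B) : Set B :=
  {x | (G.deleteEdges {s(a, b)}).Reachable a x}

section side

variable {B : Type*} {G : SimpleGraph B}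

theorem left_mem_side (G : SimpleGraph B) (a b : B) : a ∈ side G a b :=
  SimpleGraph.Reachable.refl _

theorem right_notMem_side (hG : G.IsTree) {a b : B} (hab : G.Adj a b) : b ∉ side G a b :=
  SimpleGraph.isBridge_iff.1 (SimpleGraph.isAcyclic_iff_forall_adj_isBridge.1 hG.isAcyclic hab)

theorem isCut_side (hG : G.IsTree) {a b : B} (hab : G.Adj a b) : IsCut G (side G a b) a b where
  adj := hab
  left_mem := left_mem_side G a b
  right_notMem := right_notMem_side hG hab
  eq_of_adj x z hx hz hxz := by
    by_cases he : s(x, z) = s(a, b)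
    · rcases Sym2.eq_iff.1 he with h | h
      · exact h
      · exact absurd (h.1 ▸ hx) (right_notMem_side hG hab)
    · exact absurd (hx.trans (SimpleGraph.Adj.reachable
        (SimpleGraph.deleteEdges_adj.2 ⟨hxz, he⟩))) hz

theorem mem_side_or_mem_side (hG : G.IsTree) {a b : B} (hab : G.Adj a b) (x : B) :
    x ∈ side G a b ∨ x ∈ side G b a := by
  obtain ⟨p⟩ := hG.connected.preconnected x a
  have : ∀ {u v : B} (_ : G.Walk u v), v = a → u ∈ side G a b ∨ u ∈ side G b a := by
    intro u v p hv
    induction p with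
    | nil => exact Or.inl (hv ▸ left_mem_side _ _ _)
    | @cons u w _ h _ ih =>
      rcases ih hv with hw | hw
      · by_cases hu : u ∈ side G a b
        · exact Or.inl hu
        · exact Or.inr (((isCut_side hG hab).eq_of_adj hw hu h.symm).2 ▸ left_mem_side _ _ _)
      · by_cases hu : u ∈ side G b a
        · exact Or.inr hu
        · exact Or.inl (((isCut_side hG hab.symm).eq_of_adj hw hu h.symm).2 ▸ left_mem_side _ _ _)
  exact this p rfl

theorem notMem_side_iff (hG : G.IsTree) {a b : B} (hab : G.Adj a b) (x : B) :
    x ∉ side G a b ↔ x ∈ side G b a := by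
  refine ⟨(mem_side_or_mem_side hG hab x).resolve_left, fun h h' => ?_⟩
  refine right_notMem_side hG hab (h'.trans ?_)
  rw [side, Set.mem_ofPred_eq, Sym2.eq_swap] at h
  exact h.symm

/-- `side G c d` is connected by edges among its own vertices, and `s(a, b)` is not one of them
because `a` lies outside. -/
theorem mem_side_of_mem_side {a b c d x y : B} (ha : a ∉ side G c d) (hx : x ∈ side G c d)
    (hy : y ∈ side G c d) (hxa : x ∈ side G a b) : y ∈ side G a b := by
  obtain ⟨p⟩ : (G.deleteEdges {s(c, d)}).Reachable x y := hx.symm.trans hy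
  induction p with
  | nil => exact hxa
  | @cons u w _ h _ ih =>
    have hw : w ∈ side G c d := hx.trans h.reachable
    refine ih hw hy (hxa.trans (SimpleGraph.Adj.reachable
      (SimpleGraph.deleteEdges_adj.2 ⟨(SimpleGraph.deleteEdges_adj.1 h).1, ?_⟩)))
    intro he
    rcases Sym2.eq_iff.1 he with h' | h'
    · exact ha (h'.1 ▸ hx)
    · exact ha (h'.2 ▸ hw)

/-- For a root `r` these are the subtrees hanging below `a` and `c`. A vertex of the first outside
the second could be joined to `r` within `side G d c`, hence without using `s(a, b)`. -/
theorem side_subset_side (hG : G.IsTree) {a b c d r : B} (hcd : G.Adj c d) (ha : a ∈ side G c d)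
    (hr : r ∉ side G c d) (hra : r ∉ side G a b) : side G a b ⊆ side G c d := by
  intro x hx
  by_contra hxc
  rw [notMem_side_iff hG hcd] at hr hxc
  exact hra (mem_side_of_mem_side ((notMem_side_iff hG hcd.symm a).2 ha) hxc hr hx)

theorem subset_side_or_disjoint {a b c d : B} (ha : a ∉ side G c d) :
    side G c d ⊆ side G a b ∨ Disjoint (side G a b) (side G c d) := by
  by_cases h : ∃ x ∈ side G c d, x ∈ side G a b
  · obtain ⟨x, hx, hxa⟩ := h
    exact Or.inl fun y hy => mem_side_of_mem_side ha hx hy hxa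
  · exact Or.inr (Set.disjoint_left.2 fun x hx hx' => h ⟨x, hx', hx⟩)

end side

/-! ### Flow conservation across a cut. -/

section injection

variable {B E : Type*} [Fintype B] [AddCommGroup E]

open scoped Classical in
/-- The net flow out of `x` for potentials `W` and line admittances `y`. -/
noncomputable def injection (G : SimpleGraph B) (y : Sym2 B → E →+ E) (W : B → E) (x : B) : E :=
  ∑ z, if G.Adj x z then y s(x, z) (W x - W z) else 0

open scoped Classical in
theorem IsCut.sum_injection [IsAddTorsionFree E] {G : SimpleGraph B} {S : Set B} {a b : B}
    (h : IsCut G S a b) (y : Sym2 B → E →+ E) (W : B → E) :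
    ∑ x with x ∈ S, injection G y W x = y s(a, b) (W a - W b) := by
  set φ : B → B → E := fun x z => if G.Adj x z then y s(x, z) (W x - W z) else 0 with hφ
  have hanti : ∀ x z, φ x z = -φ z x := by
    intro x z
    simp only [hφ, G.adj_comm z x, Sym2.eq_swap (a := z)]
    split_ifs
    · rw [← map_neg, neg_sub]
    · simp
  -- Flows inside `S` cancel: by antisymmetry the double sum equals its own negative.
  have hin : ∑ x with x ∈ S, ∑ z with z ∈ S, φ x z = 0 := by
    rw [← self_eq_neg, ← Finset.sum_neg_distrib]
    conv_lhs => rw [Finset.sum_comm]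
    refine Finset.sum_congr rfl fun x _ => ?_
    rw [← Finset.sum_neg_distrib]
    exact Finset.sum_congr rfl fun z _ => hanti z x
  have hout : ∑ x with x ∈ S, ∑ z with z ∉ S, φ x z = φ a b := by
    rw [Finset.sum_eq_single_of_mem a (by simpa using h.left_mem),
      Finset.sum_eq_single_of_mem b (by simpa using h.right_notMem)]
    · intro z hz hne
      exact if_neg fun hadj => hne (h.eq_of_adj h.left_mem (by simpa using hz) hadj).2
    · intro x hx hne
      refine Finset.sum_eq_zero fun z hz => if_neg fun hadj => hne ?_
      exact (h.eq_of_adj (by simpa using hx) (by simpa using hz) hadj).1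
  calc ∑ x with x ∈ S, injection G y W x
      = ∑ x with x ∈ S, (∑ z with z ∈ S, φ x z + ∑ z with z ∉ S, φ x z) :=
        Finset.sum_congr rfl fun x _ => (Finset.sum_filter_add_sum_filter_not _ _ _).symm
    _ = y s(a, b) (W a - W b) := by
        rw [Finset.sum_add_distrib, hin, hout, zero_add]
        exact if_pos h.adj

end injection

/-! ### Voltages as functions of the injections on either side of an edge. -/

section flow

open scoped Classical in
theorem potential_sub_eq {N Ω E : Type*} [Fintype N] [AddCommGroup E] [IsAddTorsionFree E]
    {G : SimpleGraph (Option N)} {y z : Sym2 (Option N) → E →+ E} {V Q : Option N → Ω → E} (hG : G.IsTree) (hzy : ∀ a b, G.Adj a b → ∀ u, z s(a, b) (y s(a, b) u) = u)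
    (hQV : ∀ x ω, Q x ω = injection G y (fun c => V c ω) x)
    {a b : Option N} (hab : G.Adj a b) (ω : Ω) :
    V a ω - V b ω = z s(a, b) (∑ x with x ∈ side G a b, Q x ω) := by
  simp_rw [hQV]
  rw [(isCut_side hG hab).sum_injection, hzy a b hab]

variable {N Ω E : Type*} [MeasurableSpace E]

/-- The σ-algebra generated by the variables at the non-root buses that lie in `A`. -/
abbrev sigmaOn (Q : Option N → Ω → E) (A : Set (Option N)) : MeasurableSpace Ω :=
  ⨆ n ∈ {n : N | some n ∈ A}, MeasurableSpace.comap (Q (some n)) inferInstance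

theorem measurable_sigmaOn (Q : Option N → Ω → E) {A : Set (Option N)} {x : Option N}
    (hx : x ∈ A) (hr : x ≠ none) : Measurable[sigmaOn Q A] (Q x) := by
  obtain ⟨n, rfl⟩ := Option.ne_none_iff_exists'.1 hr
  exact (comap_measurable _).mono (le_iSup₂_of_le n hx le_rfl) le_rfl

theorem sigmaOn_le [mΩ : MeasurableSpace Ω] {Q : Option N → Ω → E}
    (hQ : ∀ n, Measurable (Q (some n))) (A : Set (Option N)) : sigmaOn Q A ≤ mΩ :=
  iSup₂_le fun n _ => (hQ n).comap_le

theorem indep_sigmaOn_compl [mΩ : MeasurableSpace Ω] {μ : Measure Ω} {Q : Option N → Ω → E}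
    (hQ : ∀ n, Measurable (Q (some n))) (hind : iIndepFun (fun n => Q (some n)) μ)
    (A : Set (Option N)) : Indep (sigmaOn Q Aᶜ) (sigmaOn Q A) μ :=
  indep_iSup_of_disjoint (fun n => (hQ n).comap_le) hind
    (Set.disjoint_left.2 fun _ h h' => h h')

variable [Fintype N] [AddCommGroup E] [MeasurableAdd₂ E]

open scoped Classical in
theorem measurable_sum_sigmaOn (Q : Option N → Ω → E) {A A' : Set (Option N)} (h : A ⊆ A')
    (hr : none ∉ A) : Measurable[sigmaOn Q A'] fun ω => ∑ x with x ∈ A, Q x ω := by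
  let _ := sigmaOn Q A'
  refine Finset.measurable_sum _ fun x hx => ?_
  have hx : x ∈ A := by simpa using hx
  exact measurable_sigmaOn Q (h hx) fun h0 => hr (h0 ▸ hx)

variable [MeasurableSub₂ E] [IsAddTorsionFree E] {G : SimpleGraph (Option N)}
  {y z : Sym2 (Option N) → E →+ E} {V Q : Option N → Ω → E}

/-- The drop along an edge inside the side is determined by the injections of the subtree below it,
which stays in the side. The drops telescope along a walk from `l` to `j`. -/
theorem measurable_potential_sub_of_mem_side (hG : G.IsTree)
    (hzy : ∀ a b, G.Adj a b → ∀ u, z s(a, b) (y s(a, b) u) = u) (hz : ∀ e, Measurable (z e))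
    (hQV : ∀ x ω, Q x ω = injection G y (fun c => V c ω) x)
    {i j l : Option N} (hij : G.Adj j i) (hr : none ∉ side G j i) (hl : l ∈ side G j i) :
    Measurable[sigmaOn Q (side G j i)]
      fun ω => V l ω - V j ω := by
  let _ := sigmaOn Q (side G j i)
  have hdir : ∀ {a b}, G.Adj a b → a ∈ side G j i → none ∉ side G a b →
      Measurable[sigmaOn Q (side G j i)] fun ω => V a ω - V b ω := by
    intro a b hab ha hrab
    simp_rw [potential_sub_eq hG hzy hQV hab]
    exact (hz _).comp (measurable_sum_sigmaOn Q (side_subset_side hG hij ha hr hrab) hrab)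
  have hedge : ∀ {a b}, G.Adj a b → a ∈ side G j i → b ∈ side G j i →
      Measurable[sigmaOn Q (side G j i)] fun ω => V a ω - V b ω := by
    intro a b hab ha hb
    by_cases hrab : none ∈ side G a b
    · have := hdir hab.symm hb ((notMem_side_iff hG hab.symm _).2 hrab)
      simpa only [zero_sub, neg_sub] using (measurable_const (a := (0 : E))).fun_sub this
    · exact hdir hab ha hrab
  obtain ⟨p⟩ : (G.deleteEdges {s(j, i)}).Reachable l j := SimpleGraph.Reachable.symm hl
  have : ∀ {u v : Option N} (_ : (G.deleteEdges {s(j, i)}).Walk u v), v = j → u ∈ side G j i →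
      Measurable[sigmaOn Q (side G j i)] fun ω => V u ω - V v ω := by
    intro u v p hv hu
    induction p with
    | nil => simpa only [sub_self] using measurable_const
    | @cons u w v h _ ih =>
      have hw : w ∈ side G j i := hu.trans h.reachable
      simpa only [sub_add_sub_cancel] using
        (hedge (SimpleGraph.deleteEdges_adj.1 h).1 hu hw).fun_add (ih hv hw)
  exact this p rfl hl

open scoped Classical in
-- Telescope from `k` to the substation, whose potential is constant. The subtree below each edge on
-- the way either contains the side, whose injections then enter only through their sum, or is
-- disjoint from it.
theorem exists_measurable_potential_sub_of_notMem_side (hG : G.IsTree)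
    (hzy : ∀ a b, G.Adj a b → ∀ u, z s(a, b) (y s(a, b) u) = u) (hz : ∀ e, Measurable (z e))
    (hQV : ∀ x ω, Q x ω = injection G y (fun c => V c ω) x)
    {c₀ : E} (href : ∀ ω, V none ω = c₀)
    {i j k : Option N} (hij : G.Adj j i) (hr : none ∉ side G j i) (hk : k ∉ side G j i) :
    ∃ c : E → E, Measurable c ∧
      Measurable[sigmaOn Q (side G j i)ᶜ]
        fun ω => V k ω -
          c (∑ x with x ∈ side G j i, Q x ω) := by
  set D := side G j i with hD
  let _ := sigmaOn Q Dᶜ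
  have hdir : ∀ {a b}, G.Adj a b → a ∉ D → none ∉ side G a b →
      ∃ c : E → E, Measurable c ∧
        Measurable[sigmaOn Q Dᶜ] fun ω => V a ω - V b ω - c (∑ x with x ∈ D, Q x ω) := by
    intro a b hab ha hrab
    rcases subset_side_or_disjoint (b := b) ha with hsub | hdisj
    · refine ⟨z s(a, b), hz _, ?_⟩
      have hsplit : ∀ ω, V a ω - V b ω - z s(a, b) (∑ x with x ∈ D, Q x ω) =
          z s(a, b) (∑ x with x ∈ side G a b \ D, Q x ω) := by
        intro ω
        rw [potential_sub_eq hG hzy hQV hab, ← map_sub]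
        congr 1
        rw [sub_eq_iff_eq_add, ← Finset.sum_union]
        · refine Finset.sum_congr (Finset.ext fun x => ?_) fun _ _ => rfl
          simp only [Finset.mem_filter_univ, Finset.mem_union, Set.mem_sdiff]
          exact ⟨fun h => (em (x ∈ D)).elim Or.inr fun h' => Or.inl ⟨h, h'⟩,
            fun h => h.elim And.left fun h' => hsub h'⟩
        · refine Finset.disjoint_filter.2 fun x _ h h' => h.2 h'
      simp_rw [hsplit]
      have hsum := measurable_sum_sigmaOn Q (A := side G a b \ D) (A' := Dᶜ) (fun _ h => h.2)
        fun h => hrab h.1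
      convert (hz s(a, b)).comp hsum with ω
      rw [Function.comp_apply]
      congr!
    · refine ⟨fun _ => 0, measurable_const, ?_⟩
      simp_rw [sub_zero, potential_sub_eq hG hzy hQV hab]
      exact (hz _).comp (measurable_sum_sigmaOn Q hdisj.subset_compl_right hrab)
  have hedge : ∀ {a b}, G.Adj a b → a ∉ D → b ∉ D →
      ∃ c : E → E, Measurable c ∧
        Measurable[sigmaOn Q Dᶜ] fun ω => V a ω - V b ω - c (∑ x with x ∈ D, Q x ω) := by
    intro a b hab ha hb
    by_cases hrab : none ∈ side G a b
    · obtain ⟨c, hc, hm⟩ := hdir hab.symm hb ((notMem_side_iff hG hab.symm _).2 hrab)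
      -- Negation is written as a subtraction because measurability is assumed only for addition and
      -- subtraction.
      refine ⟨fun e => 0 - c e, measurable_const.sub hc, ?_⟩
      convert (measurable_const (a := (0 : E))).fun_sub hm using 2
      beta_reduce
      abel
    · exact hdir hab ha hrab
  have hwalk : ∀ {u v : Option N} (_ : (G.deleteEdges {s(i, j)}).Walk u v), v = none → u ∉ D →
      ∃ c : E → E, Measurable c ∧
        Measurable[sigmaOn Q Dᶜ] fun ω => V u ω - c (∑ x with x ∈ D, Q x ω) := by
    intro u v p hv hu
    induction p with
    | nil =>
      refine ⟨fun _ => 0, measurable_const, ?_⟩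
      simp_rw [hv, href, sub_zero]
      exact measurable_const
    | @cons u w v h _ ih =>
      have hw : w ∉ D := by
        rw [hD, notMem_side_iff hG hij] at hu ⊢
        exact hu.trans h.reachable
      obtain ⟨c, hc, hm⟩ := hedge (SimpleGraph.deleteEdges_adj.1 h).1 hu hw
      obtain ⟨c', hc', hm'⟩ := ih hv hw
      refine ⟨fun e => c e + c' e, hc.add hc', ?_⟩
      convert hm.fun_add hm' using 2
      beta_reduce
      abel
  rw [hD, notMem_side_iff hG hij] at hr
  obtain ⟨p⟩ : (G.deleteEdges {s(i, j)}).Reachable k none :=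
    SimpleGraph.Reachable.trans (SimpleGraph.Reachable.symm ((notMem_side_iff hG hij k).1 hk)) hr
  exact hwalk p rfl hk

theorem condIndepFun_potential_of_adj [mΩ : MeasurableSpace Ω] [StandardBorelSpace Ω]
    {μ : Measure Ω} [IsProbabilityMeasure μ] (hG : G.IsTree)
    (hzy : ∀ a b, G.Adj a b → ∀ u, z s(a, b) (y s(a, b) u) = u) (hz : ∀ e, Measurable (z e))
    (hQV : ∀ x ω, Q x ω = injection G y (fun c => V c ω) x)
    (hy : ∀ e, Measurable (y e)) {c₀ : E} (href : ∀ ω, V none ω = c₀)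
    (hQ : ∀ n, Measurable (Q (some n))) (hind : iIndepFun (fun n => Q (some n)) μ)
    {i j k l : Option N} (hij : G.Adj j i) (hr : none ∉ side G j i)
    (hk : k ∉ side G j i) (hl : l ∈ side G j i)
    (hm : MeasurableSpace.comap (V i) inferInstance ⊔ MeasurableSpace.comap (V j) inferInstance
      ≤ mΩ) :
    CondIndepFun _ hm (V k) (V l) μ := by
  classical
  set D := side G j i with hD
  set F : Ω → E := fun ω => ∑ x with x ∈ D, Q x ω with hF
  have hFV : ∀ ω, F ω = y s(j, i) (V j ω - V i ω) := fun ω => by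
    simp_rw [hF, hQV]
    exact (isCut_side hG hij).sum_injection y _
  have hzF : ∀ ω, z s(j, i) (F ω) = V j ω - V i ω := fun ω => by rw [hFV, hzy j i hij]
  obtain ⟨ci, hci, hRi⟩ := exists_measurable_potential_sub_of_notMem_side hG hzy hz hQV href
    hij hr (right_notMem_side hG hij)
  obtain ⟨ck, hck, hRk⟩ := exists_measurable_potential_sub_of_notMem_side hG hzy hz hQV href
    hij hr hk
  have hl' := measurable_potential_sub_of_mem_side hG hzy hz hQV hij hr hl
  set R : Ω → E := fun ω => V i ω - ci (F ω) with hR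
  have hFm : Measurable[sigmaOn Q D] F := measurable_sum_sigmaOn Q subset_rfl hr
  have hpre := condIndep_sup_of_indep (sigmaOn_le hQ Dᶜ) (sigmaOn_le hQ D)
    (indep_sigmaOn_compl hQ hind D) hRi.comap_le hFm.comap_le
  set m := MeasurableSpace.comap (V i) inferInstance ⊔ MeasurableSpace.comap (V j) inferInstance
    with hmdef
  have hVi : Measurable[m] (V i) := (comap_measurable _).mono le_sup_left le_rfl
  have hVj : Measurable[m] (V j) := (comap_measurable _).mono le_sup_right le_rfl
  have hFg : Measurable[m] F := by
    rw [funext hFV]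
    exact (hy _).comp (hVj.sub hVi)
  have hRg : Measurable[m] R := hVi.sub (hci.comp hFg)
  -- The change of variables `F = y (V j - V i)`, `R = V i - ci F` is inverted by `V i = R + ci F`,
  -- `V j = V i + z F`.
  have hmeq : m = MeasurableSpace.comap R inferInstance ⊔ MeasurableSpace.comap F inferInstance := by
    apply le_antisymm
    · set m' := MeasurableSpace.comap R inferInstance ⊔ MeasurableSpace.comap F inferInstance
      have hR' : Measurable[m'] R := (comap_measurable _).mono le_sup_left le_rfl
      have hF' : Measurable[m'] F := (comap_measurable _).mono le_sup_right le_rfl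
      have hi' : Measurable[m'] (V i) := by
        convert hR'.add (hci.comp hF') using 1
        ext ω
        simp [hR]
      have hj' : Measurable[m'] (V j) := by
        convert hi'.add ((hz s(j, i)).comp hF') using 1
        ext ω
        simp [hzF]
      exact sup_le hi'.comap_le hj'.comap_le
    · exact sup_le hRg.comap_le hFg.comap_le
  have hcore : CondIndep m (sigmaOn Q Dᶜ ⊔ m) (sigmaOn Q D ⊔ m) hm μ := by
    simpa only [← hmeq] using hpre (hmeq ▸ hm)
  rw [condIndepFun_iff_condIndep]
  have hVk : Measurable[sigmaOn Q Dᶜ ⊔ m] (V k) := by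
    change Measurable[sigmaOn Q Dᶜ] fun ω => V k ω - ck (F ω) at hRk
    have h1 := hRk.mono (le_sup_left : _ ≤ sigmaOn Q Dᶜ ⊔ m) le_rfl
    have h2 := (hck.comp hFg).mono (le_sup_right : _ ≤ sigmaOn Q Dᶜ ⊔ m) le_rfl
    simpa only [Function.comp_def, sub_add_cancel] using h1.fun_add h2
  have hVl : Measurable[sigmaOn Q D ⊔ m] (V l) := by
    have h1 := hl'.mono (le_sup_left : _ ≤ sigmaOn Q D ⊔ m) le_rfl
    have h2 := hVj.mono (le_sup_right : _ ≤ sigmaOn Q D ⊔ m) le_rfl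
    simpa only [sub_add_cancel] using h1.fun_add h2
  exact condIndep_of_condIndep_of_le_left (condIndep_of_condIndep_of_le_right hcore hVl.comap_le)
    hVk.comap_le

end flow

theorem condIndepGivenPair_swap {N Ω E : Type*} [MeasurableSpace E] [MeasurableSpace Ω]
    [StandardBorelSpace Ω] {μ : Measure Ω} [IsFiniteMeasure μ] {V : N → Ω → E}
    (hV : ∀ n, Measurable (V n)) {i j k l : N} (h : CondIndepGivenPair μ hV l k j i) :
    CondIndepGivenPair μ hV k l i j := by
  have h' := CondIndepFun.symm h
  unfold CondIndepGivenPair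
  convert h' using 1
  exact ((MeasurableSpace.comap_prodMk _ _).trans (sup_comm _ _)).trans
    (MeasurableSpace.comap_prodMk _ _).symm

/-! ### The equivalence for a general additive network flow. -/

section network

variable {N Ω E : Type*} [Fintype N] [AddCommGroup E] [IsAddTorsionFree E] [MeasurableSpace E]
  [MeasurableAdd₂ E] [MeasurableSub₂ E] [MeasurableSpace Ω] [StandardBorelSpace Ω]

theorem exists_condIndepGivenPair_iff {μ : Measure Ω} [IsProbabilityMeasure μ]
    {G : SimpleGraph (Option N)} (hG : G.IsTree) (hload : (loadTree G).Connected)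
    {y z : Sym2 (Option N) → E →+ E}
    (hzy : ∀ a b, G.Adj a b → ∀ u, z s(a, b) (y s(a, b) u) = u)
    (hz : ∀ e, Measurable (z e)) (hy : ∀ e, Measurable (y e))
    {V : Option N → Ω → E} {c₀ : E} (href : ∀ ω, V none ω = c₀)
    (hV : ∀ n, Measurable (V (some n)))
    (hQ : ∀ n, Measurable fun ω => injection G y (fun c => V c ω) (some n))
    (hind : iIndepFun (fun (n : N) ω => injection G y (fun c => V c ω) (some n)) μ)
    (hfaith : FaithfulTo (hopGraph (loadTree G)) μ hV) {i j : N} :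
    ((loadTree G).Adj i j ∧ IsNonLeaf (loadTree G) i ∧ IsNonLeaf (loadTree G) j) ↔
      ∃ k l : N, [i, j, k, l].Nodup ∧ CondIndepGivenPair μ hV k l i j := by
  constructor
  · rintro ⟨hij, hi, hj⟩
    obtain ⟨k, hik, hkj⟩ := hi.exists_adj_ne j
    obtain ⟨l, hjl, hli⟩ := hj.exists_adj_ne i
    have hG' : G.Adj (some i) (some j) := hij
    have hki : some k ∈ side G (some i) (some j) := by
      by_contra h
      have := ((isCut_side hG hG').eq_of_adj (left_mem_side _ _ _) h hik).2
      exact hkj (Option.some.inj this)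
    have hlj : some l ∈ side G (some j) (some i) := by
      by_contra h
      have := ((isCut_side hG hG'.symm).eq_of_adj (left_mem_side _ _ _) h hjl).2
      exact hli (Option.some.inj this)
    have hlk : k ≠ l := by
      rintro rfl
      exact (notMem_side_iff hG hG' _).2 hlj hki
    refine ⟨k, l, ?_, ?_⟩
    · simp [hij.ne, hik.ne, hjl.ne, hkj.symm, hli.symm, hlk]
    · have key : ∀ {i j k l : N}, G.Adj (some i) (some j) →
          none ∉ side G (some j) (some i) → some k ∈ side G (some i) (some j) →
          some l ∈ side G (some j) (some i) → CondIndepGivenPair μ hV k l i j := by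
        intro i j k l hij hr hk hl
        have h := condIndepFun_potential_of_adj (μ := μ) (V := V)
          (Q := fun x ω => injection G y (fun c => V c ω) x) hG hzy hz (fun _ _ => rfl) hy href
          hQ hind hij.symm hr ((notMem_side_iff hG hij.symm _).2 hk) hl
          (sup_le (hV i).comap_le (hV j).comap_le)
        unfold CondIndepGivenPair
        convert h using 1
        exact MeasurableSpace.comap_prodMk _ _
      -- `key` needs the substation off the side of its second endpoint; otherwise exchange the
      -- roles of the endpoints.
      by_cases hr : none ∈ side G (some j) (some i)
      · exact condIndepGivenPair_swap hV
          (key hG'.symm ((notMem_side_iff hG hG' _).2 hr) hlj hki)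
      · exact key hG' hr hki hlj
  · rintro ⟨k, l, hnd, hkl⟩
    have hsep : Separates (hopGraph (loadTree G)) {i, j} k l := by
      by_contra h
      exact hfaith i j k l hnd h hkl
    simp only [List.nodup_cons, List.mem_cons, List.not_mem_nil, or_false, not_or] at hnd
    refine adj_and_isNonLeaf_of_separates hload ?_ ?_ hsep
    · simp only [Set.mem_insert_iff, Set.mem_singleton_iff, not_or]
      exact ⟨Ne.symm hnd.1.2.1, Ne.symm hnd.2.1.1⟩
    · simp only [Set.mem_insert_iff, Set.mem_singleton_iff, not_or]
      exact ⟨Ne.symm hnd.1.2.2, Ne.symm hnd.2.1.2⟩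

end network

/-! ### The two power-flow models as network flows. -/

theorem IsLCPF.injection_eq {N : Type*} [Fintype N] {G : SimpleGraph (Option N)}
    {Z : Sym2 (Option N) → ℂ} {v θ : Option N → ℝ} {P : N → ℂ} (h : IsLCPF G Z v θ P) (n : N) :
    injection G (fun e => AddMonoidHom.mulLeft (star (Z e))⁻¹)
      (fun b => (v b : ℂ) - Complex.I * (θ b : ℂ)) (some n) = P n := by
  rw [h.flow, injection]
  refine Finset.sum_congr rfl fun j _ => ?_
  split_ifs
  · rw [AddMonoidHom.coe_mulLeft]
    push_cast
    ring
  · rfl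

/-- The diagonal rotation of the phases by their reference angles. -/
noncomputable def phaseRotation (u : Fin 3 → ℂ) : Fin 3 → ℂ :=
  fun α => Complex.exp (-(Complex.I * (θref α : ℂ))) * u α

theorem measurable_phaseRotation : Measurable phaseRotation :=
  measurable_pi_lambda _ fun α => (measurable_pi_apply α).const_mul _

/-- The phase factors `e^{𝐢 (θref α - θref β)}` are a conjugation by the diagonal rotation, so in
rotated coordinates the line admittance is just the matrix `Y`. -/
theorem IsLCPF3.injection_eq {N : Type*} [Fintype N] {G : SimpleGraph (Option N)}
    {Z : Sym2 (Option N) → Matrix (Fin 3) (Fin 3) ℂ} {v θ : Option N → Fin 3 → ℝ}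
    {P : N → Fin 3 → ℂ} (h : IsLCPF3 G Z v θ P) (n : N) :
    injection G (fun e => (Matrix.mulVecLin ((Z e).conjTranspose)⁻¹).toAddMonoidHom)
      (fun b => phaseRotation fun α => (v b α : ℂ) - Complex.I * (θ b α : ℂ)) (some n) =
        phaseRotation (P n) := by
  classical
  ext α
  rw [phaseRotation, h.flow, injection, Finset.sum_apply, Finset.mul_sum]
  simp_rw [Finset.mul_sum]
  rw [Finset.sum_comm]
  refine Finset.sum_congr rfl fun j _ => ?_
  split_ifs
  · simp only [LinearMap.toAddMonoidHom_coe, Matrix.mulVecLin_apply, Matrix.mulVec, dotProduct,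
      Pi.sub_apply, phaseRotation]
    refine Finset.sum_congr rfl fun β _ => ?_
    have he : Complex.exp (-(Complex.I * (θref β : ℂ))) =
        Complex.exp (-(Complex.I * (θref α : ℂ))) *
          Complex.exp (Complex.I * ((θref α - θref β : ℝ) : ℂ)) := by
      rw [← Complex.exp_add]
      congr 1
      push_cast
      ring
    rw [he]
    push_cast
    ring
  · simp

end PowerGrid

theorem theorem1 {N : Type*} [Fintype N] (G : SimpleGraph (Option N)) (hG : G.IsTree)
    (hload : (PowerGrid.loadTree G).Connected)
    (hdepth : PowerGrid.DepthGreaterThanThree (PowerGrid.loadTree G))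
    {Ω : Type*} [MeasurableSpace Ω] [StandardBorelSpace Ω]
    (μ : MeasureTheory.Measure Ω) [MeasureTheory.IsProbabilityMeasure μ]
    (i j : N) (hij : i ≠ j) :
    (∀ (Z : Sym2 (Option N) → ℂ) (v θ : Option N → Ω → ℝ) (P : N → Ω → ℂ)
        (hv : ∀ b, Measurable (v b)) (hθ : ∀ b, Measurable (θ b)),
      (∀ a b, G.Adj a b → Z s(a, b) ≠ 0) →
      (∀ ω, PowerGrid.IsLCPF G Z (fun b => v b ω) (fun b => θ b ω) (fun n => P n ω)) →
      PowerGrid.IndependentInjections P μ →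
      PowerGrid.FaithfulTo (PowerGrid.hopGraph (PowerGrid.loadTree G)) μ
        (PowerGrid.measurable_voltage₁ hv hθ) →
      (((PowerGrid.loadTree G).Adj i j ∧ PowerGrid.IsNonLeaf (PowerGrid.loadTree G) i ∧
          PowerGrid.IsNonLeaf (PowerGrid.loadTree G) j) ↔
        ∃ k l : N, [i, j, k, l].Nodup ∧
          PowerGrid.CondIndepGivenPair μ (PowerGrid.measurable_voltage₁ hv hθ) k l i j)) ∧
    (∀ (Z : Sym2 (Option N) → Matrix (Fin 3) (Fin 3) ℂ)
        (v θ : Option N → Ω → Fin 3 → ℝ) (P : N → Ω → Fin 3 → ℂ)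
        (hv : ∀ b, Measurable (v b)) (hθ : ∀ b, Measurable (θ b)),
      (∀ a b, G.Adj a b → (Z s(a, b)).IsSymm ∧ IsUnit (Z s(a, b)).det) →
      (∀ ω, PowerGrid.IsLCPF3 G Z (fun b => v b ω) (fun b => θ b ω) (fun n => P n ω)) →
      PowerGrid.IndependentInjections P μ →
      PowerGrid.FaithfulTo (PowerGrid.hopGraph (PowerGrid.loadTree G)) μ
        (PowerGrid.measurable_voltage₃ hv hθ) →
      (((PowerGrid.loadTree G).Adj i j ∧ PowerGrid.IsNonLeaf (PowerGrid.loadTree G) i ∧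
          PowerGrid.IsNonLeaf (PowerGrid.loadTree G) j) ↔
        ∃ k l : N, [i, j, k, l].Nodup ∧
          PowerGrid.CondIndepGivenPair μ (PowerGrid.measurable_voltage₃ hv hθ) k l i j)) := by
  constructor
  · intro Z v θ P hv hθ hZ hflow hP hfaith
    set V : Option N → Ω → ℂ := fun b ω => (v b ω : ℂ) - Complex.I * (θ b ω : ℂ)
    have hinj : ∀ n, (fun ω => PowerGrid.injection G
        (fun e => AddMonoidHom.mulLeft (star (Z e))⁻¹) (fun b => V b ω) (some n)) = P n :=
      fun n => funext fun ω => (hflow ω).injection_eq n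
    refine PowerGrid.exists_condIndepGivenPair_iff (V := V) (c₀ := 1)
      (y := fun e => AddMonoidHom.mulLeft (star (Z e))⁻¹)
      (z := fun e => AddMonoidHom.mulLeft (star (Z e))) hG hload ?_ ?_ ?_ ?_
      (PowerGrid.measurable_voltage₁ hv hθ) ?_ ?_ hfaith
    · intro a b hab u
      exact mul_inv_cancel_left₀ (star_ne_zero.2 (hZ a b hab)) u
    · exact fun e => measurable_const_mul _
    · exact fun e => measurable_const_mul _
    · intro ω
      simp [V, (hflow ω).ref_magnitude, (hflow ω).ref_angle]
    · intro n
      rw [hinj]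
      exact hP.measurable n
    · rw [funext hinj]
      exact hP.indep
  · intro Z v θ P hv hθ hZ hflow hP hfaith
    set V : Option N → Ω → Fin 3 → ℂ := fun b ω =>
      PowerGrid.phaseRotation fun α => (v b ω α : ℂ) - Complex.I * (θ b ω α : ℂ)
    have hinj : ∀ n, (fun ω => PowerGrid.injection G
        (fun e => (Matrix.mulVecLin ((Z e).conjTranspose)⁻¹).toAddMonoidHom)
        (fun b => V b ω) (some n)) = PowerGrid.phaseRotation ∘ P n :=
      fun n => funext fun ω => (hflow ω).injection_eq n
    refine PowerGrid.exists_condIndepGivenPair_iff (V := V)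
      (c₀ := PowerGrid.phaseRotation fun α => 1 - Complex.I * (PowerGrid.θref α : ℂ))
      (y := fun e => (Matrix.mulVecLin ((Z e).conjTranspose)⁻¹).toAddMonoidHom)
      (z := fun e => (Matrix.mulVecLin (Z e).conjTranspose).toAddMonoidHom) hG hload ?_ ?_ ?_ ?_
      (PowerGrid.measurable_voltage₃ hv hθ) ?_ ?_ hfaith
    · intro a b hab u
      have hdet : IsUnit ((Z s(a, b)).conjTranspose).det := by
        rw [Matrix.det_conjTranspose]
        exact (hZ a b hab).2.star
      simp [Matrix.mulVec_mulVec, Matrix.mul_nonsing_inv _ hdet]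
    · exact fun e =>
        ((Z e).conjTranspose.mulVecLin.continuous_of_finiteDimensional).measurable
    · exact fun e =>
        (((Z e).conjTranspose)⁻¹.mulVecLin.continuous_of_finiteDimensional).measurable
    · intro ω
      simp [V, (hflow ω).ref_magnitude, (hflow ω).ref_angle]
    · intro n
      rw [hinj]
      exact PowerGrid.measurable_phaseRotation.comp (hP.measurable n)
    · rw [funext hinj]
      -- The network injections are the rotated `P n`; applying a measurable map at each bus
      -- preserves joint independence.
      exact hP.indep.comp _ fun _ => PowerGrid.measurable_phaseRotation
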